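/- Let $n\ge 1$ and $\alpha\in\mathbb R$. A rectangular box in $\mathbb R^n$ is a Cartesian product of $n$ nonempty bounded open intervals, and a cube is a box whose edges all have the same length. For a box $\mathcal B$, let $\lambda_1(\mathcal B;\alpha)$ be the smallest eigenvalue $\lambda$ of the Robin Laplacian $$-\Delta u=\lambda u \ \text{ in } \mathcal B,\qquad \frac{\partial u}{\partial\nu}+\alpha u=0\ \text{ on }\partial\mathcal B ,$$ in the weak sense: there is a nonzero $u\in H^1(\mathcal B)$ with $\int_{\mathcal B}\nabla u\cdot\nabla v\,dx+\alpha\int_{\partial\mathcal B}uv\,dS=\lambda\int_{\mathcal B}uv\,dx$ for all $v\in H^1(\mathcal B)$, boundary values being taken in the sense of traces. Then: (i) If $\alpha>0$, then $\lambda_1(\mathcal B;\alpha)>0$ for every rectangular box $\mathcal B$, and among rectangular boxes of given volume $\lambda_1(\,\cdot\,;\alpha)$ is minimal for the cube and only for the cube. (ii) If $\alpha<0$, then $\lambda_1(\mathcal B;\alpha)<0$ for every rectangular box $\mathcal B$, and among rectangular boxes of given volume $\lambda_1(\,\cdot\,;\alpha)$ is maximal for the cube and only for the cube. (iii) If $\alpha\neq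 0$, then, writing $\mathcal B(w)=(-w_1,w_1)\times\cdots\times(-w_n,w_n)$ and $e^z=(e^{z_1},\dots,e^{z_n})$, the function $z\mapsto\sqrt{|\lambda_1(\mathcal B(e^z);\alpha)|}$ is strictly convex on $\mathbb R^n$. -/

import Mathlib

open MeasureTheory Set Filter Topology
open scoped ContDiff ENNReal

/-- Surface measure `dS` on the boundary of `Ω ⊆ ℝⁿ`: the `(n-1)`-dimensional Hausdorff measure,
normalized so as to agree with Euclidean `(n-1)`-volume on hyperplanes (counting measure if
`n = 1`), restricted to `∂Ω`. -/
noncomputable def surfaceMeasure {n : ℕ} (Ω : Set (EuclideanSpace ℝ (Fin n))) :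
    Measure (EuclideanSpace ℝ (Fin n)) :=
  (Measure.euclideanHausdorffMeasure (n - 1)).restrict (frontier Ω)

/-- `G` is a weak (distributional) gradient of `u` in the open set `Ω`:
`∫_Ω u ∂ᵢφ dx = - ∫_Ω Gᵢ φ dx` for every `φ ∈ C_c^∞(Ω)` and every `i`. -/
def HasWeakGradient {n : ℕ} (Ω : Set (EuclideanSpace ℝ (Fin n)))
    (u : EuclideanSpace ℝ (Fin n) → ℝ)
    (G : EuclideanSpace ℝ (Fin n) → EuclideanSpace ℝ (Fin n)) : Prop :=
  ∀ φ : EuclideanSpace ℝ (Fin n) → ℝ, ContDiff ℝ ∞ φ → HasCompactSupport φ → tsupport φ ⊆ Ω →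
    ∀ i : Fin n, ∫ x in Ω, u x * gradient φ x i = - ∫ x in Ω, G x i * φ x

/-- `u ∈ H¹(Ω)`, with weak gradient `G`. -/
structure InH1 {n : ℕ} (Ω : Set (EuclideanSpace ℝ (Fin n)))
    (u : EuclideanSpace ℝ (Fin n) → ℝ)
    (G : EuclideanSpace ℝ (Fin n) → EuclideanSpace ℝ (Fin n)) : Prop where
  memLp : MemLp u 2 (volume.restrict Ω)
  memLp_gradient : MemLp G 2 (volume.restrict Ω)
  weakGradient : HasWeakGradient Ω u G

/-- `g ∈ L²(∂Ω)` is the boundary trace of `u ∈ H¹(Ω)` (with weak gradient `G`). The trace operator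
is the continuous extension to `H¹(Ω)` of the restriction map `v ↦ v|_∂Ω` on functions smooth up to
the boundary, so `g` is the `L²(∂Ω)`-limit of `v k|_∂Ω` for smooth `v k → u` in `H¹(Ω)`. On a
bounded Lipschitz domain each `u ∈ H¹(Ω)` has exactly one trace. -/
def HasTrace {n : ℕ} (Ω : Set (EuclideanSpace ℝ (Fin n)))
    (u : EuclideanSpace ℝ (Fin n) → ℝ)
    (G : EuclideanSpace ℝ (Fin n) → EuclideanSpace ℝ (Fin n))
    (g : EuclideanSpace ℝ (Fin n) → ℝ) : Prop :=
  MemLp g 2 (surfaceMeasure Ω) ∧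
  ∃ v : ℕ → EuclideanSpace ℝ (Fin n) → ℝ, (∀ k, ContDiff ℝ ∞ (v k)) ∧
    Tendsto (fun k => eLpNorm (fun x => v k x - u x) 2 (volume.restrict Ω)) atTop (𝓝 0) ∧
    Tendsto (fun k => eLpNorm (fun x => gradient (v k) x - G x) 2 (volume.restrict Ω))
      atTop (𝓝 0) ∧
    Tendsto (fun k => eLpNorm (fun x => v k x - g x) 2 (surfaceMeasure Ω)) atTop (𝓝 0)

/-- `μ` is an eigenvalue of the Robin Laplacian `-Δu = μ u` in `Ω`, `∂u/∂ν + α u = 0` on `∂Ω`,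
in the weak sense: there is `u ∈ H¹(Ω)`, `u ≠ 0`, such that
`∫_Ω ∇u · ∇v dx + α ∫_∂Ω u v dS = μ ∫_Ω u v dx` for all `v ∈ H¹(Ω)`. -/
def IsRobinEigenvalue {n : ℕ} (Ω : Set (EuclideanSpace ℝ (Fin n))) (α μ : ℝ) : Prop :=
  ∃ (u : EuclideanSpace ℝ (Fin n) → ℝ)
    (Gu : EuclideanSpace ℝ (Fin n) → EuclideanSpace ℝ (Fin n))
    (gu : EuclideanSpace ℝ (Fin n) → ℝ),
    InH1 Ω u Gu ∧ HasTrace Ω u Gu gu ∧ ¬ (∀ᵐ x ∂(volume.restrict Ω), u x = 0) ∧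
    ∀ (v : EuclideanSpace ℝ (Fin n) → ℝ)
      (Gv : EuclideanSpace ℝ (Fin n) → EuclideanSpace ℝ (Fin n))
      (gv : EuclideanSpace ℝ (Fin n) → ℝ),
      InH1 Ω v Gv → HasTrace Ω v Gv gv →
      (∫ x in Ω, inner ℝ (Gu x) (Gv x)) + α * ∫ x, gu x * gv x ∂(surfaceMeasure Ω)
        = μ * ∫ x in Ω, u x * v x

/-- The first (lowest) Robin eigenvalue `λ₁(Ω; α)`. -/
noncomputable def robinLambda1 {n : ℕ} (Ω : Set (EuclideanSpace ℝ (Fin n))) (α : ℝ) : ℝ :=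
  sInf {μ : ℝ | IsRobinEigenvalue Ω α μ}

/-- The box `(a₁, b₁) × ⋯ × (aₙ, bₙ)`. -/
def openBox {n : ℕ} (a b : Fin n → ℝ) : Set (EuclideanSpace ℝ (Fin n)) :=
  {x | ∀ i, x i ∈ Ioo (a i) (b i)}

/-- A rectangular box: a Cartesian product of `n` nonempty bounded open intervals. -/
def IsRectangularBox {n : ℕ} (B : Set (EuclideanSpace ℝ (Fin n))) : Prop :=
  ∃ a b : Fin n → ℝ, (∀ i, a i < b i) ∧ B = openBox a b

/-- A cube: a rectangular box all of whose edges have the same length. -/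
def IsCube {n : ℕ} (B : Set (EuclideanSpace ℝ (Fin n))) : Prop :=
  ∃ (a : Fin n → ℝ) (ℓ : ℝ), 0 < ℓ ∧ B = openBox a (fun i => a i + ℓ)

/-- The centered box `(-w₁, w₁) × ⋯ × (-wₙ, wₙ)` with half-widths `w`. -/
def centeredBox {n : ℕ} (w : Fin n → ℝ) : Set (EuclideanSpace ℝ (Fin n)) :=
  openBox (fun i => - w i) w

/-! Separation of variables reduces the box to its edges. If `uᵢ > 0` solves the Robin problem on
the `i`-th edge with eigenvalue `μᵢ`, then `U = ∏ uᵢ(xᵢ)` is a positive eigenfunction on the box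
with eigenvalue `∑ μᵢ`. No eigenvalue is smaller: the components `φᵢ = uᵢ'/uᵢ` of `∇ log U` satisfy
the Riccati equations `φᵢ' = -μᵢ - φᵢ²`, and the divergence theorem for the field `v² ∇ log U`,
followed by completing a square, bounds the Rayleigh quotient of every smooth `v` from below by `∑
μᵢ` (`robin_quadratic_form_ge`, `robinLambda1_openBox`).

On an interval of half-width `w = e^z` the eigenvalue is `k²` with `k tan(kw) = α` if `α > 0`, and
`-k²` with `k tanh(kw) = -α` if `α < 0`. In the parameter `t = kw` both `z` and `k` are explicit,
and `dk/dz = -|α| / (sin² t / t + tan t)`, or its hyperbolic analogue. The denominator is strictly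
increasing, so `k = g(z)` is a strictly convex positive function (`exists_robinProfile_of_pos`,
`exists_robinProfile_of_neg`).

Hence `|λ₁| = ∑ g(zᵢ)²`, where the `zᵢ` are the logarithms of the half-widths. Its square root is
the Euclidean norm of `(g(zᵢ))`, which is strictly convex because the norm is convex and increasing
on the positive orthant. Fixing the volume fixes `∑ zᵢ`, so the strict Jensen inequality for `g²`
singles out the cube. -/

/-! ### Strict convexity of a parametrized curve -/

/-- A function whose graph is the curve `t ↦ (Z t, K t)` with `Z' > 0` and `K' / Z'` strictly
increasing is strictly convex. -/
theorem strictConvexOn_of_parametrization {I : Set ℝ} (hI : I.OrdConnected)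
    {Z Z' K s T : ℝ → ℝ} (hZ : ∀ t ∈ I, HasDerivAt Z (Z' t) t) (hZ' : ∀ t ∈ I, 0 < Z' t)
    (hK : ∀ t ∈ I, HasDerivAt K (s t * Z' t) t) (hs : StrictMonoOn s I)
    (hT : ∀ z, T z ∈ I) (hZT : ∀ z, Z (T z) = z) :
    StrictConvexOn ℝ univ (fun z => K (T z)) := by
  have hmono : StrictMonoOn Z I := by
    refine strictMonoOn_of_hasDerivWithinAt_pos (f' := Z') hI.convex ?_ ?_ ?_
    · exact fun t ht => (hZ t ht).continuousAt.continuousWithinAt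
    · exact fun t ht => (hZ t (interior_subset ht)).hasDerivWithinAt
    · exact fun t ht => hZ' t (interior_subset ht)
  have hlt : ∀ {x y}, x < y → T x < T y := fun {x y} h => by
    rw [← hmono.lt_iff_lt (hT x) (hT y), hZT, hZT]; exact h
  have key : ∀ {x y}, x < y → ∃ c ∈ Ioo (T x) (T y), (K (T y) - K (T x)) / (y - x) = s c := by
    intro x y h
    have hsub : Icc (T x) (T y) ⊆ I := hI.out (hT x) (hT y)
    -- Cauchy's mean value theorem: each chord slope is a value of `s = K'/Z'` between the
    -- endpoints, so adjacent chords have strictly increasing slopes.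
    obtain ⟨c, hc, h1⟩ := exists_ratio_hasDerivAt_eq_ratio_slope Z Z' (hlt h)
      (fun t ht => (hZ t (hsub ht)).continuousAt.continuousWithinAt)
      (fun t ht => hZ t (hsub (Ioo_subset_Icc_self ht))) K (fun t => s t * Z' t)
      (fun t ht => (hK t (hsub ht)).continuousAt.continuousWithinAt)
      (fun t ht => hK t (hsub (Ioo_subset_Icc_self ht)))
    refine ⟨c, hc, ?_⟩
    rw [hZT, hZT] at h1
    have h2 := hZ' c (hsub (Ioo_subset_Icc_self hc))
    rw [div_eq_iff (sub_pos.2 h).ne']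
    apply mul_right_cancel₀ h2.ne'
    linarith
  refine strictConvexOn_of_slope_strict_mono_adjacent convex_univ ?_
  intro x y z _ _ hxy hyz
  obtain ⟨c, hc, h1⟩ := key hxy
  obtain ⟨d, hd, h2⟩ := key hyz
  rw [h1, h2]
  exact hs (hI.out (hT x) (hT y) (Ioo_subset_Icc_self hc))
    (hI.out (hT y) (hT z) (Ioo_subset_Icc_self hd)) (hc.2.trans hd.1)

/-! ### The Robin problem on an interval -/

/-- `u` is a positive first eigenfunction of the Robin problem on `[a, b]` with eigenvalue `μ`,
and `φ` is its logarithmic derivative. -/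
structure IsRobinProfile (α μ a b : ℝ) (u φ : ℝ → ℝ) : Prop where
  contDiff : ContDiff ℝ ∞ u
  pos : ∀ x ∈ Icc a b, 0 < u x
  hasDerivAt : ∀ x ∈ Icc a b, HasDerivAt u (φ x * u x) x
  riccati : ∀ x ∈ Icc a b, HasDerivAt φ (-μ - φ x ^ 2) x
  left : φ a = α
  right : φ b = -α

/-- The eigenfunction is even about the midpoint. At the endpoints its argument is `±t`, and `t <
π/2` keeps the cosine positive up to the boundary. -/
theorem isRobinProfile_cos {k t a b : ℝ} (hk : 0 < k) (ht : t < Real.pi / 2)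
    (hab : k * ((b - a) / 2) = t) :
    IsRobinProfile (k * Real.tan t) (k ^ 2) a b (fun x => Real.cos (k * (x - (a + b) / 2)))
      (fun x => -(k * Real.tan (k * (x - (a + b) / 2)))) := by
  have hin : ∀ x ∈ Icc a b, 0 < Real.cos (k * (x - (a + b) / 2)) := by
    intro x hx
    apply Real.cos_pos_of_mem_Ioo
    have h1 := mul_le_mul_of_nonneg_left hx.1 hk.le
    have h2 := mul_le_mul_of_nonneg_left hx.2 hk.le
    constructor <;> nlinarith
  have hlin : ∀ x, HasDerivAt (fun x => k * (x - (a + b) / 2)) k x := fun x => by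
    simpa using ((hasDerivAt_id x).sub_const ((a + b) / 2)).const_mul k
  refine ⟨by fun_prop, hin, ?_, ?_, ?_, ?_⟩
  · intro x hx
    have h := (hlin x).cos
    refine HasDerivAt.congr_deriv h ?_
    rw [Real.tan_eq_sin_div_cos]
    have := (hin x hx).ne'
    generalize k * (x - (a + b) / 2) = θ at this ⊢
    field_simp
  · intro x hx
    have h := (((Real.hasDerivAt_tan (hin x hx).ne').comp x (hlin x)).const_mul k).neg
    refine HasDerivAt.congr_deriv h ?_
    rw [Real.tan_eq_sin_div_cos]
    have := (hin x hx).ne'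
    generalize k * (x - (a + b) / 2) = θ at this ⊢
    field_simp
    linear_combination Real.sin_sq_add_cos_sq θ
  · have : k * (a - (a + b) / 2) = -t := by rw [← hab]; ring
    simp [this]
  · have : k * (b - (a + b) / 2) = t := by rw [← hab]; ring
    simp [this]

theorem isRobinProfile_cosh {k t a b : ℝ} (hab : k * ((b - a) / 2) = t) :
    IsRobinProfile (-(k * (Real.sinh t / Real.cosh t))) (-k ^ 2) a b
      (fun x => Real.cosh (k * (x - (a + b) / 2)))
      (fun x => k * (Real.sinh (k * (x - (a + b) / 2)) / Real.cosh (k * (x - (a + b) / 2)))) := by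
  have hlin : ∀ x, HasDerivAt (fun x => k * (x - (a + b) / 2)) k x := fun x => by
    simpa using ((hasDerivAt_id x).sub_const ((a + b) / 2)).const_mul k
  refine ⟨Real.contDiff_cosh.comp (by fun_prop), fun x _ => Real.cosh_pos _, ?_, ?_, ?_, ?_⟩
  · intro x hx
    have h := (hlin x).cosh
    refine HasDerivAt.congr_deriv h ?_
    have := (Real.cosh_pos (k * (x - (a + b) / 2))).ne'
    generalize k * (x - (a + b) / 2) = θ at this ⊢
    field_simp
  · intro x hx
    have h := ((hlin x).sinh.div (hlin x).cosh (Real.cosh_pos _).ne').const_mul k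
    refine HasDerivAt.congr_deriv h ?_
    have := (Real.cosh_pos (k * (x - (a + b) / 2))).ne'
    generalize k * (x - (a + b) / 2) = θ at this ⊢
    field_simp
  · have : k * (a - (a + b) / 2) = -t := by rw [← hab]; ring
    simp [this, neg_div]
  · have : k * (b - (a + b) / 2) = t := by rw [← hab]; ring
    simp [this]

/-- This is the denominator of `dk/dz` for `α > 0`. In its derivative the only negative term is
`-sin² t / t² > -1`, outweighed by `1 / cos² t ≥ 1`. -/
theorem strictMonoOn_sin_sq_div_add_tan :
    StrictMonoOn (fun t => Real.sin t ^ 2 / t + Real.sin t / Real.cos t) (Ioo 0 (Real.pi / 2)) := by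
  have hcos : ∀ t ∈ Ioo 0 (Real.pi / 2), 0 < Real.cos t := fun t ht =>
    Real.cos_pos_of_mem_Ioo ⟨by linarith [ht.1, Real.pi_pos], ht.2⟩
  have hd : ∀ t ∈ Ioo 0 (Real.pi / 2),
      HasDerivAt (fun t => Real.sin t ^ 2 / t + Real.sin t / Real.cos t)
        ((2 * Real.sin t * Real.cos t * t - Real.sin t ^ 2) / t ^ 2 + 1 / Real.cos t ^ 2) t := by
    intro t ht
    have h := (((Real.hasDerivAt_sin t).pow 2).div (hasDerivAt_id t) ht.1.ne').add
      ((Real.hasDerivAt_sin t).div (Real.hasDerivAt_cos t) (hcos t ht).ne')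
    refine HasDerivAt.congr_deriv h ?_
    simp only [Pi.pow_apply, id]
    have := Real.sin_sq_add_cos_sq t
    have hc := (hcos t ht).ne'
    have ht0 := ht.1.ne'
    field_simp
    push_cast
    linear_combination t ^ 2 * this
  refine strictMonoOn_of_hasDerivWithinAt_pos (convex_Ioo _ _)
    (fun t ht => (hd t ht).continuousAt.continuousWithinAt)
    (fun t ht => (hd t (interior_subset ht)).hasDerivWithinAt) ?_
  intro t ht
  replace ht := interior_subset ht
  have hc := hcos t ht
  have hs : 0 < Real.sin t := Real.sin_pos_of_pos_of_lt_pi ht.1 (by linarith [ht.2, Real.pi_pos])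
  have h1 : Real.sin t ^ 2 / t ^ 2 < 1 := by
    rw [div_lt_one (by have := ht.1; positivity)]
    exact pow_lt_pow_left₀ (Real.sin_lt ht.1) hs.le two_ne_zero
  have h2 : 1 ≤ 1 / Real.cos t ^ 2 := by
    rw [le_div_iff₀ (by positivity)]
    nlinarith [Real.sin_sq_add_cos_sq t]
  have h3 : 0 < 2 * Real.sin t * Real.cos t * t / t ^ 2 := by have := ht.1; positivity
  rw [sub_div]
  linarith

/-- Hyperbolic counterpart, for `α < 0`. Here `1 / cosh² t` is less than `1`, so the negative term
is absorbed instead by `2 t sinh t cosh t`, through `sinh t ≤ t cosh t`. -/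
theorem strictMonoOn_sinh_sq_div_add_tanh :
    StrictMonoOn (fun t => Real.sinh t ^ 2 / t + Real.sinh t / Real.cosh t) (Ioi 0) := by
  have hd : ∀ t ∈ Ioi (0 : ℝ),
      HasDerivAt (fun t => Real.sinh t ^ 2 / t + Real.sinh t / Real.cosh t)
        ((2 * Real.sinh t * Real.cosh t * t - Real.sinh t ^ 2) / t ^ 2 + 1 / Real.cosh t ^ 2) t := by
    intro t ht
    have h := (((Real.hasDerivAt_sinh t).pow 2).div (hasDerivAt_id t) (ne_of_gt ht)).add
      ((Real.hasDerivAt_sinh t).div (Real.hasDerivAt_cosh t) (Real.cosh_pos t).ne')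
    refine HasDerivAt.congr_deriv h ?_
    simp only [Pi.pow_apply, id]
    have := Real.cosh_sq_sub_sinh_sq t
    field_simp
    push_cast
    linear_combination this
  refine strictMonoOn_of_hasDerivWithinAt_pos (convex_Ioi _)
    (fun t ht => (hd t ht).continuousAt.continuousWithinAt)
    (fun t ht => (hd t (interior_subset ht)).hasDerivWithinAt) ?_
  intro t ht
  replace ht : 0 < t := interior_subset ht
  have hs : 0 < Real.sinh t := Real.sinh_pos_iff.2 ht
  have hc := Real.cosh_pos t
  have h1 : Real.sinh t ≤ t * Real.cosh t := by
    have hm : MonotoneOn (fun t => t * Real.cosh t - Real.sinh t) (Ici 0) := by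
      have hd : ∀ t, HasDerivAt (fun t => t * Real.cosh t - Real.sinh t) (t * Real.sinh t) t := by
        intro t
        exact HasDerivAt.congr_deriv (((hasDerivAt_id t).mul (Real.hasDerivAt_cosh t)).sub
          (Real.hasDerivAt_sinh t)) (by simp)
      refine monotoneOn_of_hasDerivWithinAt_nonneg (convex_Ici _)
        (fun t _ => (hd t).continuousAt.continuousWithinAt)
        (fun t _ => (hd t).hasDerivWithinAt) ?_
      intro t ht
      have ht : 0 ≤ t := interior_subset ht
      exact mul_nonneg ht (Real.sinh_nonneg_iff.2 ht)
    have := hm self_mem_Ici ht.le ht.le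
    simp at this
    linarith
  have h2 : 0 ≤ 2 * Real.sinh t * Real.cosh t * t - Real.sinh t ^ 2 := by
    have h3 : 0 < Real.sinh t * Real.cosh t * t := by positivity
    nlinarith
  positivity

/-- With `w = e^z` the half-width and `t = kw`, the condition `k tan t = α` becomes `t sin t = α e^z
cos t`, whence `k = α cot t`. The root `t = T z` is chosen in `(0, π/2)`, where the eigenfunction is
positive. -/
theorem exists_robinProfile_of_pos {α : ℝ} (hα : 0 < α) :
    ∃ g : ℝ → ℝ, (∀ z, 0 < g z) ∧ StrictConvexOn ℝ univ g ∧ ∀ a b, a < b →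
      ∃ u φ, IsRobinProfile α (g (Real.log ((b - a) / 2)) ^ 2) a b u φ := by
  have hpi := Real.pi_pos
  have hex : ∀ z : ℝ, ∃ t ∈ Ioo 0 (Real.pi / 2), t * Real.sin t = α * Real.exp z * Real.cos t := by
    intro z
    have h0 : 0 < α * Real.exp z := by positivity
    -- Cleared of its denominator, the equation `t tan t = α e^z` stays continuous up to `π/2`; the
    -- difference of the two sides goes from `-α e^z` to `π/2`.
    obtain ⟨t, ht, h⟩ := intermediate_value_Ioo (α := ℝ) (δ := ℝ) (a := 0) (b := Real.pi / 2)
      (f := fun t => t * Real.sin t - α * Real.exp z * Real.cos t) (by positivity) (by fun_prop)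
      (show (0 : ℝ) ∈ _ by simpa using ⟨h0, hpi⟩)
    exact ⟨t, ht, by simpa [sub_eq_zero] using h⟩
  choose T hT hTz using hex
  have hsin : ∀ t ∈ Ioo 0 (Real.pi / 2), 0 < Real.sin t := fun t ht =>
    Real.sin_pos_of_pos_of_lt_pi ht.1 (by linarith [ht.2])
  have hcos : ∀ t ∈ Ioo 0 (Real.pi / 2), 0 < Real.cos t := fun t ht =>
    Real.cos_pos_of_mem_Ioo ⟨by linarith [ht.1], ht.2⟩
  refine ⟨fun z => α * Real.cos (T z) / Real.sin (T z), fun z => ?_, ?_, ?_⟩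
  · have := hsin _ (hT z); have := hcos _ (hT z); positivity
  · refine strictConvexOn_of_parametrization (I := Ioo 0 (Real.pi / 2))
      (Z := fun t => Real.log (t * Real.sin t / (α * Real.cos t)))
      (Z' := fun t => 1 / t + 1 / (Real.sin t * Real.cos t))
      (K := fun t => α * Real.cos t / Real.sin t)
      (s := fun t => - (α / (Real.sin t ^ 2 / t + Real.sin t / Real.cos t))) ordConnected_Ioo
      ?_ ?_ ?_ ?_ hT ?_
    · intro t ht
      have hs := hsin t ht
      have hc := hcos t ht
      have ht0 := ht.1
      have h := (((hasDerivAt_id t).mul (Real.hasDerivAt_sin t)).div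
        ((Real.hasDerivAt_cos t).const_mul α) (by positivity)).log
        (by simp only [Pi.mul_apply, Pi.div_apply, id]; positivity)
      refine HasDerivAt.congr_deriv h ?_
      simp only [Pi.mul_apply, Pi.div_apply, id]
      field_simp
      have := Real.sin_sq_add_cos_sq t
      linear_combination t * this
    · intro t ht
      have := hsin t ht; have := hcos t ht; have := ht.1; positivity
    · intro t ht
      have hs := hsin t ht
      have hc := hcos t ht
      have ht0 := ht.1
      have h := ((Real.hasDerivAt_cos t).const_mul α).div (Real.hasDerivAt_sin t) hs.ne'
      refine HasDerivAt.congr_deriv h ?_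
      have := Real.sin_sq_add_cos_sq t
      field_simp
      rw [← this]
      have h1 : Real.sin t * Real.cos t + t ≠ 0 := by positivity
      field_simp
      ring
    · intro x hx y hy hxy
      have h1 := strictMonoOn_sin_sq_div_add_tan hx hy hxy
      have : 0 < Real.sin x ^ 2 / x + Real.sin x / Real.cos x := by
        have := hsin x hx; have := hcos x hx; have := hx.1; positivity
      exact neg_lt_neg (div_lt_div_of_pos_left hα this h1)
    · intro z
      have hc := hcos _ (hT z)
      simp only [hTz]
      rw [show α * Real.exp z * Real.cos (T z) / (α * Real.cos (T z)) = Real.exp z by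
        field_simp, Real.log_exp]
  · intro a b hab
    set t := T (Real.log ((b - a) / 2)) with ht
    have hw : 0 < (b - a) / 2 := by linarith
    have h1 := hTz (Real.log ((b - a) / 2))
    rw [Real.exp_log hw, ← ht] at h1
    have hs := hsin t (hT _)
    have hc := hcos t (hT _)
    have h2 := isRobinProfile_cos (k := α * Real.cos t / Real.sin t) (t := t) (a := a) (b := b)
      (by positivity) (hT _).2 (by field_simp; linarith)
    rw [Real.tan_eq_sin_div_cos,
      show α * Real.cos t / Real.sin t * (Real.sin t / Real.cos t) = α by field_simp] at h2
    exact ⟨_, _, h2⟩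

/-- With `β = -α`, the condition `k tanh t = β` and `t = kw` give `t sinh t = β e^z cosh t` and `k =
β coth t`. -/
theorem exists_robinProfile_of_neg {α : ℝ} (hα : α < 0) :
    ∃ g : ℝ → ℝ, (∀ z, 0 < g z) ∧ StrictConvexOn ℝ univ g ∧ ∀ a b, a < b →
      ∃ u φ, IsRobinProfile α (-g (Real.log ((b - a) / 2)) ^ 2) a b u φ := by
  obtain ⟨β, rfl⟩ : ∃ β, α = -β := ⟨-α, by simp⟩
  replace hα : 0 < β := by linarith
  have hex : ∀ z : ℝ, ∃ t ∈ Ioi (0 : ℝ),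
      t * Real.sinh t = β * Real.exp z * Real.cosh t := by
    intro z
    set W := β * Real.exp z with hW
    have h0 : 0 < W := by positivity
    -- The endpoint `2W + 1` is large enough that `tanh ≥ 1/2` there: `cosh x - sinh x = e^(-x) ≤ 1
    -- ≤ x ≤ sinh x`. Thus `(2W + 1) sinh - W cosh ≥ sinh > 0`.
    have h1 : Real.cosh (2 * W + 1) ≤ 2 * Real.sinh (2 * W + 1) := by
      have h2 := Real.cosh_sub_sinh (2 * W + 1)
      have h3 : Real.exp (-(2 * W + 1)) ≤ 1 := Real.exp_le_one_iff.2 (by linarith)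
      have h4 := Real.self_le_sinh_iff.2 (show 0 ≤ 2 * W + 1 by linarith)
      linarith
    have hs : 0 < Real.sinh (2 * W + 1) := Real.sinh_pos_iff.2 (by linarith)
    obtain ⟨t, ht, h⟩ := intermediate_value_Ioo (α := ℝ) (δ := ℝ) (a := 0) (b := 2 * W + 1)
      (f := fun t => t * Real.sinh t - W * Real.cosh t) (by positivity)
      (by exact ((continuous_id.mul Real.continuous_sinh).sub
        (continuous_const.mul Real.continuous_cosh)).continuousOn)
      (show (0 : ℝ) ∈ _ by
        constructor
        · simpa using h0
        · show (0 : ℝ) < (2 * W + 1) * Real.sinh (2 * W + 1) - W * Real.cosh (2 * W + 1)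
          nlinarith)
    exact ⟨t, ht.1, by simpa [sub_eq_zero] using h⟩
  choose T hT hTz using hex
  have hsin : ∀ t ∈ Ioi (0 : ℝ), 0 < Real.sinh t := fun t ht => Real.sinh_pos_iff.2 ht
  have hcos : ∀ t, 0 < Real.cosh t := Real.cosh_pos
  refine ⟨fun z => β * Real.cosh (T z) / Real.sinh (T z), fun z => ?_, ?_, ?_⟩
  · have := hsin _ (hT z); have := hcos (T z); positivity
  · refine strictConvexOn_of_parametrization (I := Ioi 0)
      (Z := fun t => Real.log (t * Real.sinh t / (β * Real.cosh t)))
      (Z' := fun t => 1 / t + 1 / (Real.sinh t * Real.cosh t))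
      (K := fun t => β * Real.cosh t / Real.sinh t)
      (s := fun t => - (β / (Real.sinh t ^ 2 / t + Real.sinh t / Real.cosh t))) ordConnected_Ioi
      ?_ ?_ ?_ ?_ hT ?_
    · intro t ht
      have hs := hsin t ht
      have hc := hcos t
      have ht0 : 0 < t := ht
      have h := (((hasDerivAt_id t).mul (Real.hasDerivAt_sinh t)).div
        ((Real.hasDerivAt_cosh t).const_mul β) (by positivity)).log
        (by simp only [Pi.mul_apply, Pi.div_apply, id]; positivity)
      refine HasDerivAt.congr_deriv h ?_
      simp only [Pi.mul_apply, Pi.div_apply, id]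
      field_simp
      have := Real.cosh_sq_sub_sinh_sq t
      linear_combination t * this
    · intro t ht
      have := hsin t ht; have := hcos t; have ht0 : 0 < t := ht; positivity
    · intro t ht
      have hs := hsin t ht
      have hc := hcos t
      have ht0 : 0 < t := ht
      have h := ((Real.hasDerivAt_cosh t).const_mul β).div (Real.hasDerivAt_sinh t) hs.ne'
      refine HasDerivAt.congr_deriv h ?_
      have := Real.cosh_sq_sub_sinh_sq t
      field_simp
      linear_combination -this
    · intro x hx y hy hxy
      have h1 := strictMonoOn_sinh_sq_div_add_tanh hx hy hxy
      have : 0 < Real.sinh x ^ 2 / x + Real.sinh x / Real.cosh x := by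
        have := hsin x hx; have := hcos x; have ht0 : 0 < x := hx; positivity
      exact neg_lt_neg (div_lt_div_of_pos_left hα this h1)
    · intro z
      have hc := hcos (T z)
      simp only [hTz]
      rw [show β * Real.exp z * Real.cosh (T z) / (β * Real.cosh (T z)) = Real.exp z by
        field_simp, Real.log_exp]
  · intro a b hab
    set t := T (Real.log ((b - a) / 2)) with ht
    have hw : 0 < (b - a) / 2 := by linarith
    have h1 := hTz (Real.log ((b - a) / 2))
    rw [Real.exp_log hw, ← ht] at h1
    have hs := hsin t (hT _)
    have hc := hcos t
    have h2 := isRobinProfile_cosh (k := β * Real.cosh t / Real.sinh t) (t := t) (a := a) (b := b)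
      (by field_simp; linarith)
    rw [show β * Real.cosh t / Real.sinh t * (Real.sinh t / Real.cosh t) = β by field_simp] at h2
    exact ⟨_, _, h2⟩

/-! ### Surface measure on the boundary of a box -/

section SurfaceMeasure

variable {m : ℕ}

/-- The parametrization of the hyperplane `{x | x i = c}` by the remaining coordinates. -/
noncomputable def hyperplaneEmb (i : Fin (m + 1)) (c : ℝ) (y : Fin m → ℝ) :
    EuclideanSpace ℝ (Fin (m + 1)) :=
  WithLp.toLp 2 (i.insertNth (α := fun _ => ℝ) c y)

theorem continuous_hyperplaneEmb (i : Fin (m + 1)) (c : ℝ) : Continuous (hyperplaneEmb i c) :=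
  (PiLp.continuous_toLp 2 _).comp (continuous_const.finInsertNth i continuous_id)

@[simp] theorem hyperplaneEmb_same (i : Fin (m + 1)) (c : ℝ) (y : Fin m → ℝ) :
    hyperplaneEmb i c y i = c := by
  simp [hyperplaneEmb]

@[simp] theorem hyperplaneEmb_succAbove (i : Fin (m + 1)) (c : ℝ) (y : Fin m → ℝ) (j : Fin m) :
    hyperplaneEmb i c y (i.succAbove j) = y j := by
  simp [hyperplaneEmb]

/-- The parametrization is an isometry from Euclidean `m`-space onto the hyperplane, and the
normalized Hausdorff measure is invariant under isometries and equals Lebesgue measure in dimension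
`m`. -/
theorem map_hyperplaneEmb_volume (i : Fin (m + 1)) (c : ℝ) :
    (volume : Measure (Fin m → ℝ)).map (hyperplaneEmb i c) =
      (Measure.euclideanHausdorffMeasure m).restrict {x | x i = c} := by
  let I : EuclideanSpace ℝ (Fin m) → EuclideanSpace ℝ (Fin (m + 1)) :=
    fun y => hyperplaneEmb i c (WithLp.ofLp y)
  have hI : Isometry I := by
    refine Isometry.of_dist_eq fun x y => ?_
    rw [EuclideanSpace.dist_eq, EuclideanSpace.dist_eq, Fin.sum_univ_succAbove _ i]
    simp [I]
  have hr : range I = {x | x i = c} := by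
    ext x
    constructor
    · rintro ⟨y, rfl⟩
      simp [I]
    · intro hx
      refine ⟨WithLp.toLp 2 (i.removeNth (WithLp.ofLp x)), ?_⟩
      ext j
      refine i.succAboveCases ?_ (fun k => ?_) j
      · simpa [I] using hx.symm
      · simp [I, Fin.removeNth]
  rw [← hr, ← hI.map_euclideanHausdorffMeasure, EuclideanSpace.euclideanHausdorffMeasure_eq_volume,
    ← (PiLp.volume_preserving_toLp (Fin m)).map_eq, Measure.map_map hI.continuous.measurable
      (PiLp.volume_preserving_toLp (Fin m)).measurable]
  rfl

/-- The closed face of the box `[a, b]` on which the `p.1`-th coordinate is extremal. -/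
def boxFace {n : ℕ} (a b : Fin n → ℝ) (p : Fin n × Bool) : Set (EuclideanSpace ℝ (Fin n)) :=
  {x | x p.1 = (if p.2 then b p.1 else a p.1) ∧ ∀ j, x j ∈ Icc (a j) (b j)}

theorem isClosed_boxFace {n : ℕ} (a b : Fin n → ℝ) (p : Fin n × Bool) :
    IsClosed (boxFace a b p) := by
  refine IsClosed.and (isClosed_eq (by fun_prop) (by fun_prop)) ?_
  simp only [ofPred_forall]
  exact isClosed_iInter fun j => isClosed_Icc.preimage (by fun_prop)

theorem isOpen_openBox {n : ℕ} (a b : Fin n → ℝ) : IsOpen (openBox a b) := by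
  simp only [openBox, ofPred_forall]
  exact isOpen_iInter_of_finite fun j => isOpen_Ioo.preimage (by fun_prop)

theorem openBox_eq_preimage {n : ℕ} (a b : Fin n → ℝ) :
    openBox a b = WithLp.ofLp ⁻¹' (pi univ fun i => Ioo (a i) (b i)) := by
  ext x; simp [openBox]

theorem closure_openBox {n : ℕ} {a b : Fin n → ℝ} (hab : ∀ i, a i < b i) :
    closure (openBox a b) = {x | ∀ j, x j ∈ Icc (a j) (b j)} := by
  have h := (PiLp.homeomorph 2 (fun _ : Fin n => ℝ)).preimage_closure
    (pi univ fun i => Ioo (a i) (b i))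
  rw [closure_pi_set] at h
  rw [openBox_eq_preimage]
  refine h.symm.trans ?_
  ext x
  simp [closure_Ioo (hab _).ne, PiLp.homeomorph, Pi.le_def, forall_and]

theorem frontier_openBox {n : ℕ} {a b : Fin n → ℝ} (hab : ∀ i, a i < b i) :
    frontier (openBox a b) = ⋃ p, boxFace a b p := by
  rw [(isOpen_openBox a b).frontier_eq, closure_openBox hab]
  ext x
  simp only [Set.mem_sdiff, mem_ofPred_eq, openBox, boxFace, mem_iUnion, not_forall]
  constructor
  · rintro ⟨h, i, hi⟩
    by_cases h1 : x i = b i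
    · exact ⟨(i, true), by simpa using h1, h⟩
    · refine ⟨(i, false), ?_, h⟩
      have h2 := h i
      by_contra h3
      exact hi ⟨lt_of_le_of_ne h2.1 (fun h4 => h3 (by simpa using h4.symm)),
        lt_of_le_of_ne h2.2 h1⟩
  · rintro ⟨⟨i, s⟩, h1, h2⟩
    refine ⟨h2, i, fun h3 => ?_⟩
    cases s <;> simp at h1
    · exact h3.1.ne' h1
    · exact h3.2.ne h1

theorem euclideanHausdorffMeasure_inter_hyperplanes {i j : Fin (m + 1)} (hij : j ≠ i) (c d : ℝ) :
    Measure.euclideanHausdorffMeasure m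
      ({x : EuclideanSpace ℝ (Fin (m + 1)) | x j = d} ∩ {x | x i = c}) = 0 := by
  obtain ⟨k, rfl⟩ := Fin.exists_succAbove_eq hij
  have hm : MeasurableSet {x : EuclideanSpace ℝ (Fin (m + 1)) | x (i.succAbove k) = d} :=
    (isClosed_eq (by fun_prop) (by fun_prop)).measurableSet
  rw [← Measure.restrict_apply hm, ← map_hyperplaneEmb_volume,
    Measure.map_apply (continuous_hyperplaneEmb i c).measurable hm]
  simpa [preimage, volume_pi] using Measure.pi_hyperplane (fun _ : Fin m => (volume : Measure ℝ)) k d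

/-- The boundary is the union of the closed faces, and overlaps are negligible: opposite faces are
disjoint, and non-parallel faces meet inside the intersection of two distinct coordinate
hyperplanes. -/
theorem surfaceMeasure_openBox {a b : Fin (m + 1) → ℝ} (hab : ∀ i, a i < b i) :
    surfaceMeasure (openBox a b) = ∑ p : Fin (m + 1) × Bool,
      (volume.restrict (Icc (a ∘ p.1.succAbove) (b ∘ p.1.succAbove))).map
        (hyperplaneEmb p.1 (if p.2 then b p.1 else a p.1)) := by
  rw [surfaceMeasure, frontier_openBox hab, Measure.restrict_iUnion_ae, Measure.sum_fintype]
  · refine Finset.sum_congr rfl fun p _ => ?_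
    have h1 : boxFace a b p ⊆ {x | x p.1 = if p.2 then b p.1 else a p.1} := fun x hx => hx.1
    rw [← Measure.restrict_restrict_of_subset h1]
    simp only [Nat.add_sub_cancel]
    rw [← map_hyperplaneEmb_volume,
      Measure.restrict_map (continuous_hyperplaneEmb _ _).measurable
        (isClosed_boxFace a b p).measurableSet]
    congr 2
    ext y
    simp only [boxFace, mem_preimage, mem_ofPred_eq, hyperplaneEmb_same, true_and,
      p.1.forall_iff_succAbove, hyperplaneEmb_succAbove, mem_Icc, Pi.le_def, Function.comp]
    rw [forall_and]
    refine and_iff_right ?_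
    split_ifs
    · exact ⟨(hab _).le, le_rfl⟩
    · exact ⟨le_rfl, (hab _).le⟩
  · rintro ⟨i, s⟩ ⟨j, t⟩ hne
    by_cases hij : i = j
    · subst hij
      refine Disjoint.aedisjoint (disjoint_left.2 fun x hx hy => ?_)
      have h1 := hx.1
      have h2 := hy.1
      have h3 := hab i
      cases s <;> cases t <;> simp at h1 h2 hne <;> linarith
    · exact measure_mono_null (inter_subset_inter (fun x hx => hx.1) (fun x hx => hx.1))
        (euclideanHausdorffMeasure_inter_hyperplanes hij _ _)
  · exact fun p => (isClosed_boxFace a b p).measurableSet.nullMeasurableSet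

theorem isFiniteMeasure_surfaceMeasure_openBox {a b : Fin (m + 1) → ℝ} (hab : ∀ i, a i < b i) :
    IsFiniteMeasure (surfaceMeasure (openBox a b)) := by
  rw [surfaceMeasure_openBox hab]
  refine ⟨?_⟩
  simp only [Measure.coe_finsetSum, Finset.sum_apply]
  refine ENNReal.sum_lt_top.2 fun p _ => ?_
  rw [Measure.map_apply (continuous_hyperplaneEmb _ _).measurable MeasurableSet.univ]
  simp only [preimage_univ, Measure.restrict_apply_univ]
  exact isCompact_Icc.measure_lt_top

theorem isBounded_openBox {n : ℕ} (a b : Fin n → ℝ) : Bornology.IsBounded (openBox a b) := by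
  have h := (isCompact_univ_pi fun i => isCompact_Icc (a := a i) (b := b i)).image
    (PiLp.continuous_toLp 2 (fun _ : Fin n => ℝ))
  refine h.isBounded.subset fun x hx => ⟨WithLp.ofLp x, fun i _ => Ioo_subset_Icc_self (hx i), rfl⟩

theorem isCompact_closure_openBox {n : ℕ} (a b : Fin n → ℝ) : IsCompact (closure (openBox a b)) :=
  (isBounded_openBox a b).isCompact_closure

theorem memLp_surfaceMeasure_of_continuous {a b : Fin (m + 1) → ℝ} (hab : ∀ i, a i < b i)
    {f : EuclideanSpace ℝ (Fin (m + 1)) → ℝ} (hf : Continuous f) (p : ℝ≥0∞) :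
    MemLp f p (surfaceMeasure (openBox a b)) := by
  have := isFiniteMeasure_surfaceMeasure_openBox hab
  obtain ⟨C, hC⟩ := (isCompact_closure_openBox a b).exists_bound_of_continuousOn hf.continuousOn
  refine MemLp.of_bound hf.aestronglyMeasurable C ?_
  refine (ae_restrict_mem isClosed_frontier.measurableSet).mono fun x hx => hC x ?_
  exact frontier_subset_closure hx

theorem integral_surfaceMeasure_openBox {a b : Fin (m + 1) → ℝ} (hab : ∀ i, a i < b i)
    {f : EuclideanSpace ℝ (Fin (m + 1)) → ℝ} (hf : Continuous f) :
    ∫ x, f x ∂surfaceMeasure (openBox a b) = ∑ i,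
      ((∫ y in Icc (a ∘ i.succAbove) (b ∘ i.succAbove), f (hyperplaneEmb i (b i) y)) +
        ∫ y in Icc (a ∘ i.succAbove) (b ∘ i.succAbove), f (hyperplaneEmb i (a i) y)) := by
  have hi : Integrable f (surfaceMeasure (openBox a b)) :=
    memLp_one_iff_integrable.1 (memLp_surfaceMeasure_of_continuous hab hf 1)
  rw [surfaceMeasure_openBox hab] at hi ⊢
  rw [integral_finsetSum_measure (fun p hp => (integrable_finsetSum_measure.1 hi) p hp),
    Fintype.sum_prod_type]
  refine Finset.sum_congr rfl fun i _ => ?_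
  rw [Fintype.sum_bool]
  simp only [if_true, Bool.false_eq_true, if_false]
  rw [integral_map (continuous_hyperplaneEmb _ _).aemeasurable hf.aestronglyMeasurable,
    integral_map (continuous_hyperplaneEmb _ _).aemeasurable hf.aestronglyMeasurable]

end SurfaceMeasure

/-! ### The divergence theorem on a box -/

section Divergence

theorem gradient_apply_eq_fderiv {n : ℕ} (f : EuclideanSpace ℝ (Fin n) → ℝ)
    (x : EuclideanSpace ℝ (Fin n)) (i : Fin n) :
    gradient f x i = fderiv ℝ f x (EuclideanSpace.single i 1) := by
  rw [gradient, ← InnerProductSpace.toDual_symm_apply, real_inner_comm,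
    EuclideanSpace.inner_single_left]
  simp

theorem continuous_gradient {n : ℕ} {f : EuclideanSpace ℝ (Fin n) → ℝ} (hf : ContDiff ℝ 1 f) :
    Continuous (gradient f) :=
  (InnerProductSpace.toDual ℝ (EuclideanSpace ℝ (Fin n))).symm.continuous.comp
    (hf.continuous_fderiv one_ne_zero)

theorem setIntegral_openBox {n : ℕ} (a b : Fin n → ℝ) (f : EuclideanSpace ℝ (Fin n) → ℝ) :
    ∫ x in openBox a b, f x = ∫ y in Icc a b, f (WithLp.toLp 2 y) := by
  rw [← (PiLp.volume_preserving_toLp (Fin n)).setIntegral_preimage_emb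
    (MeasurableEquiv.toLp 2 (Fin n → ℝ)).measurableEmbedding, volume_pi,
    ← setIntegral_congr_set Measure.univ_pi_Ioo_ae_eq_Icc]
  congr 2
  ext y
  simp [openBox]

/-- The field is `f · (φ₁(x₁), …, φₙ(xₙ))`. The values `α` on the left and `-α` on the right both
give outward flux density `-α f`, so the whole boundary contributes one surface integral. -/
theorem integral_divergence_openBox {m : ℕ} {a b : Fin (m + 1) → ℝ} (hab : ∀ i, a i < b i)
    {α : ℝ} {φ φ' : Fin (m + 1) → ℝ → ℝ}
    (hφ : ∀ i, ∀ x ∈ Icc (a i) (b i), HasDerivAt (φ i) (φ' i x) x)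
    (hφ' : ∀ i, ContinuousOn (φ' i) (Icc (a i) (b i)))
    (hl : ∀ i, φ i (a i) = α) (hr : ∀ i, φ i (b i) = -α)
    {f : EuclideanSpace ℝ (Fin (m + 1)) → ℝ} (hf : ContDiff ℝ 1 f) :
    ∫ x in openBox a b, ∑ i, (φ i (x i) * gradient f x i + f x * φ' i (x i)) =
      -(α * ∫ x, f x ∂surfaceMeasure (openBox a b)) := by
  let T : (Fin (m + 1) → ℝ) →L[ℝ] EuclideanSpace ℝ (Fin (m + 1)) :=
    (PiLp.continuousLinearEquiv 2 ℝ (fun _ : Fin (m + 1) => ℝ)).symm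
  have hT : ∀ y, T y = WithLp.toLp 2 y := fun y => rfl
  have hfd : ∀ x, HasFDerivAt f (fderiv ℝ f x) x := fun x =>
    (hf.differentiable one_ne_zero x).hasFDerivAt
  let F : Fin (m + 1) → (Fin (m + 1) → ℝ) → ℝ := fun i y => φ i (y i) * f (T y)
  let F' : Fin (m + 1) → (Fin (m + 1) → ℝ) → (Fin (m + 1) → ℝ) →L[ℝ] ℝ := fun i y =>
    φ i (y i) • (fderiv ℝ f (T y)).comp T +
      f (T y) • (φ' i (y i) • ContinuousLinearMap.proj (R := ℝ) (φ := fun _ => ℝ) i)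
  have hFd : ∀ y ∈ Icc a b, ∀ i, HasFDerivAt (F i) (F' i y) y := by
    intro y hy i
    have h1 : HasFDerivAt (fun y : Fin (m + 1) → ℝ => φ i (y i))
        (φ' i (y i) • ContinuousLinearMap.proj (R := ℝ) (φ := fun _ => ℝ) i) y :=
      (hφ i (y i) ⟨hy.1 i, hy.2 i⟩).comp_hasFDerivAt y (hasFDerivAt_apply i y)
    exact h1.mul ((hfd (T y)).comp y T.hasFDerivAt)
  have hmaps : ∀ i, MapsTo (fun y : Fin (m + 1) → ℝ => y i) (Icc a b) (Icc (a i) (b i)) :=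
    fun i y hy => ⟨hy.1 i, hy.2 i⟩
  have hdiv : ∀ y, ∑ i, F' i y (Pi.single i 1) = ∑ i, (φ i (y i) * gradient f (WithLp.toLp 2 y) i +
      f (WithLp.toLp 2 y) * φ' i (y i)) := by
    intro y
    refine Finset.sum_congr rfl fun i _ => ?_
    rw [gradient_apply_eq_fderiv]
    simp [F', hT]
  have hcont : ContinuousOn (fun y => ∑ i, F' i y (Pi.single i 1)) (Icc a b) := by
    simp only [hdiv]
    refine continuousOn_finsetSum _ fun i _ => ?_
    have h1 : ContinuousOn (fun y : Fin (m + 1) → ℝ => φ i (y i)) (Icc a b) :=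
      ContinuousOn.comp (t := Icc (a i) (b i))
        (fun x hx => (hφ i x hx).continuousAt.continuousWithinAt)
        (continuous_apply i).continuousOn (hmaps i)
    have h2 : ContinuousOn (fun y : Fin (m + 1) → ℝ => φ' i (y i)) (Icc a b) :=
      (hφ' i).comp (continuous_apply i).continuousOn (hmaps i)
    have h3 : Continuous fun y : Fin (m + 1) → ℝ => gradient f (WithLp.toLp 2 y) i :=
      ((continuous_apply i).comp (PiLp.continuous_ofLp 2 _)).comp
        ((continuous_gradient hf).comp T.continuous)
    have h4 : Continuous fun y : Fin (m + 1) → ℝ => f (WithLp.toLp 2 y) :=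
      hf.continuous.comp T.continuous
    exact (h1.mul h3.continuousOn).add (h4.continuousOn.mul h2)
  have key := integral_divergence_of_hasFDerivAt_off_countable' a b (fun i => (hab i).le) F F' ∅
    countable_empty (fun i y hy => (hFd y hy i).continuousAt.continuousWithinAt)
    (fun y hy i => hFd y ⟨fun j => (hy.1 j trivial).1.le, fun j => (hy.1 j trivial).2.le⟩ i)
    (hcont.integrableOn_compact isCompact_Icc)
  rw [setIntegral_openBox, integral_surfaceMeasure_openBox hab hf.continuous, Finset.mul_sum,
    ← Finset.sum_neg_distrib]
  simp only [hdiv] at key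
  rw [key]
  refine Finset.sum_congr rfl fun i _ => ?_
  have h1 : ∀ c y, F i (i.insertNth c y) = φ i c * f (hyperplaneEmb i c y) := by
    intro c y
    simp [F, hT, hyperplaneEmb]
  simp only [h1, hl, hr, integral_const_mul]
  ring

end Divergence

/-! ### The first eigenvalue of a box by separation of variables -/

section Eigenvalue

theorem tendsto_integral_inner_of_tendsto_eLpNorm {X E ι : Type*} [MeasurableSpace X]
    {ν : Measure X} [NormedAddCommGroup E] [InnerProductSpace ℝ E] {l : Filter ι}
    {f g : ι → X → E} {f₀ g₀ : X → E} (hf : ∀ k, MemLp (f k) 2 ν) (hg : ∀ k, MemLp (g k) 2 ν)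
    (hf₀ : MemLp f₀ 2 ν) (hg₀ : MemLp g₀ 2 ν)
    (hff : Tendsto (fun k => eLpNorm (fun x => f k x - f₀ x) 2 ν) l (𝓝 0))
    (hgg : Tendsto (fun k => eLpNorm (fun x => g k x - g₀ x) 2 ν) l (𝓝 0)) :
    Tendsto (fun k => ∫ x, inner ℝ (f k x) (g k x) ∂ν) l (𝓝 (∫ x, inner ℝ (f₀ x) (g₀ x) ∂ν)) := by
  have h1 := (Lp.tendsto_Lp_iff_tendsto_eLpNorm'' f hf f₀ hf₀).2 hff
  have h2 := (Lp.tendsto_Lp_iff_tendsto_eLpNorm'' g hg g₀ hg₀).2 hgg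
  have key : ∀ {p q : X → E} (hp : MemLp p 2 ν) (hq : MemLp q 2 ν),
      inner ℝ (hp.toLp p) (hq.toLp q) = ∫ x, inner ℝ (p x) (q x) ∂ν := by
    intro p q hp hq
    rw [L2.inner_def]
    refine integral_congr_ae ?_
    filter_upwards [hp.coeFn_toLp, hq.coeFn_toLp] with x hx hy
    rw [hx, hy]
  have h3 := h1.inner (𝕜 := ℝ) h2
  simpa only [key] using h3

theorem tendsto_integral_mul_of_tendsto_eLpNorm {X ι : Type*} [MeasurableSpace X]
    {ν : Measure X} {l : Filter ι}
    {f g : ι → X → ℝ} {f₀ g₀ : X → ℝ} (hf : ∀ k, MemLp (f k) 2 ν) (hg : ∀ k, MemLp (g k) 2 ν)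
    (hf₀ : MemLp f₀ 2 ν) (hg₀ : MemLp g₀ 2 ν)
    (hff : Tendsto (fun k => eLpNorm (fun x => f k x - f₀ x) 2 ν) l (𝓝 0))
    (hgg : Tendsto (fun k => eLpNorm (fun x => g k x - g₀ x) 2 ν) l (𝓝 0)) :
    Tendsto (fun k => ∫ x, f k x * g k x ∂ν) l (𝓝 (∫ x, f₀ x * g₀ x ∂ν)) := by
  simpa [mul_comm] using tendsto_integral_inner_of_tendsto_eLpNorm hf hg hf₀ hg₀ hff hgg

theorem memLp_restrict_openBox_of_continuousOn {n : ℕ} {E : Type*} [NormedAddCommGroup E]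
    [SecondCountableTopology E] (a b : Fin n → ℝ) {f : EuclideanSpace ℝ (Fin n) → E}
    (hf : ContinuousOn f (closure (openBox a b))) (p : ℝ≥0∞) :
    MemLp f p (volume.restrict (openBox a b)) := by
  have : IsFiniteMeasure (volume.restrict (openBox a b)) :=
    isFiniteMeasure_restrict.2 (isBounded_openBox a b).measure_lt_top.ne
  obtain ⟨C, hC⟩ := (isCompact_closure_openBox a b).exists_bound_of_continuousOn hf
  refine MemLp.of_bound ((hf.mono subset_closure).aestronglyMeasurable
    (isOpen_openBox a b).measurableSet) C ?_
  exact (ae_restrict_mem (isOpen_openBox a b).measurableSet).mono fun x hx =>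
    hC x (subset_closure hx)

theorem hasWeakGradient_gradient {n : ℕ} {Ω : Set (EuclideanSpace ℝ (Fin n))}
    {u : EuclideanSpace ℝ (Fin n) → ℝ} (hu : ContDiff ℝ 1 u) :
    HasWeakGradient Ω u (gradient u) := by
  intro φ hφ hc hs i
  have hφ1 : ContDiff ℝ 1 φ := hφ.of_le (by exact_mod_cast le_top)
  have h0 : ∀ x, x ∉ Ω → φ x = 0 := fun x hx => image_eq_zero_of_notMem_tsupport fun h => hx (hs h)
  have h0' : ∀ x, x ∉ Ω → fderiv ℝ φ x = 0 := fun x hx => by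
    by_contra h
    exact hx (hs (support_fderiv_subset ℝ h))
  have hcont := hu.continuous_fderiv one_ne_zero
  have hcont' := hφ1.continuous_fderiv one_ne_zero
  simp only [gradient_apply_eq_fderiv]
  -- Both integrands vanish off `Ω`, so the integration by parts takes place on the whole space,
  -- without boundary terms.
  rw [setIntegral_eq_integral_of_forall_compl_eq_zero (fun x hx => by simp [h0' x hx]),
    setIntegral_eq_integral_of_forall_compl_eq_zero (fun x hx => by simp [h0 x hx])]
  refine integral_mul_fderiv_eq_neg_fderiv_mul_of_integrable ?_ ?_ ?_
    (fun x _ => hu.differentiable one_ne_zero x) (fun x _ => hφ1.differentiable one_ne_zero x)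
  · exact Continuous.integrable_of_hasCompactSupport (by fun_prop) hc.mul_left
  · exact Continuous.integrable_of_hasCompactSupport (by fun_prop)
      (HasCompactSupport.mul_left (hc.fderiv_apply ℝ _))
  · exact Continuous.integrable_of_hasCompactSupport (by fun_prop) hc.mul_left

theorem inner_eq_sum {n : ℕ} (x y : EuclideanSpace ℝ (Fin n)) :
    inner ℝ x y = ∑ i, x i * y i := by
  simp [PiLp.inner_apply, mul_comm]

theorem gradient_mul_apply {n : ℕ} {f g : EuclideanSpace ℝ (Fin n) → ℝ} (hf : ContDiff ℝ 1 f)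
    (hg : ContDiff ℝ 1 g) (x : EuclideanSpace ℝ (Fin n)) (i : Fin n) :
    gradient (fun x => f x * g x) x i = f x * gradient g x i + g x * gradient f x i := by
  simp only [gradient_apply_eq_fderiv]
  rw [fderiv_fun_mul (hf.differentiable one_ne_zero x) (hg.differentiable one_ne_zero x)]
  simp

/-- The separated function `x ↦ ∏ uᵢ(xᵢ)`. -/
noncomputable def tensorFun {n : ℕ} (u : Fin n → ℝ → ℝ) (x : EuclideanSpace ℝ (Fin n)) : ℝ :=
  ∏ i, u i (x i)

theorem contDiff_tensorFun {n : ℕ} {u : Fin n → ℝ → ℝ} (hu : ∀ i, ContDiff ℝ ∞ (u i)) :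
    ContDiff ℝ ∞ (tensorFun u) :=
  contDiff_prod fun i _ => (hu i).comp (by fun_prop)

theorem gradient_tensorFun_apply {n : ℕ} {u : Fin n → ℝ → ℝ} {x : EuclideanSpace ℝ (Fin n)}
    {c : Fin n → ℝ} (h : ∀ i, HasDerivAt (u i) (c i * u i (x i)) (x i)) (k : Fin n) :
    gradient (tensorFun u) x k = c k * tensorFun u x := by
  have h1 : ∀ i ∈ Finset.univ, HasFDerivAt (fun x : EuclideanSpace ℝ (Fin n) => u i (x i))
      ((c i * u i (x i)) • (EuclideanSpace.proj i : EuclideanSpace ℝ (Fin n) →L[ℝ] ℝ)) x :=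
    fun i _ => (h i).comp_hasFDerivAt x
      (EuclideanSpace.proj i : EuclideanSpace ℝ (Fin n) →L[ℝ] ℝ).hasFDerivAt
  have h2 : HasFDerivAt (tensorFun u) _ x := HasFDerivAt.finsetProd h1
  rw [gradient_apply_eq_fderiv, h2.fderiv, tensorFun,
    ← Finset.prod_erase_mul _ _ (Finset.mem_univ k)]
  simp only [_root_.sum_apply, _root_.smul_apply, smul_eq_mul,
    PiLp.proj_apply, PiLp.single_apply]
  rw [Finset.sum_eq_single k]
  · simp; ring
  · intro j _ hj; simp [hj]
  · simp

variable {m : ℕ} {a b : Fin (m + 1) → ℝ} {α : ℝ} {μ : Fin (m + 1) → ℝ}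
  {u φ : Fin (m + 1) → ℝ → ℝ}

/-- Common source of the eigenvalue equation (`f = U v`) and of the lower bound (`f = v²`): the
Riccati equation gives the divergence, the Robin condition the flux. -/
theorem integral_robinProfile (hab : ∀ i, a i < b i)
    (h : ∀ i, IsRobinProfile α (μ i) (a i) (b i) (u i) (φ i))
    {f : EuclideanSpace ℝ (Fin (m + 1)) → ℝ} (hf : ContDiff ℝ 1 f) :
    ∫ x in openBox a b, ∑ i, (φ i (x i) * gradient f x i + f x * (-μ i - φ i (x i) ^ 2)) =
      -(α * ∫ x, f x ∂surfaceMeasure (openBox a b)) :=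
  integral_divergence_openBox hab (φ' := fun i x => -μ i - φ i x ^ 2) (fun i => (h i).riccati)
    (fun i x hx => by
      have := ((h i).riccati x hx).continuousAt.continuousWithinAt (s := Icc (a i) (b i))
      exact continuousWithinAt_const.sub (this.pow 2))
    (fun i => (h i).left) (fun i => (h i).right) hf

/-- For `f = U v`, the relation `∂ᵢU = φᵢ U` cancels the `φᵢ²` terms and leaves `∂ᵢU ∂ᵢv - μᵢ U v`.
-/
theorem robin_weak_form_tensorFun (hab : ∀ i, a i < b i)
    (h : ∀ i, IsRobinProfile α (μ i) (a i) (b i) (u i) (φ i))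
    {v : EuclideanSpace ℝ (Fin (m + 1)) → ℝ} (hv : ContDiff ℝ 1 v) :
    (∫ x in openBox a b, inner ℝ (gradient (tensorFun u) x) (gradient v x)) +
      α * ∫ x, tensorFun u x * v x ∂surfaceMeasure (openBox a b) =
      (∑ i, μ i) * ∫ x in openBox a b, tensorFun u x * v x := by
  have hU : ContDiff ℝ 1 (tensorFun u) :=
    (contDiff_tensorFun fun i => (h i).contDiff).of_le (by exact_mod_cast le_top)
  have key := integral_robinProfile hab h (hU.mul hv)
  have h1 : ∫ x in openBox a b, ∑ i, (φ i (x i) * gradient (fun x => tensorFun u x * v x) x i +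
      tensorFun u x * v x * (-μ i - φ i (x i) ^ 2)) =
      ∫ x in openBox a b, (inner ℝ (gradient (tensorFun u) x) (gradient v x) -
        (∑ i, μ i) * (tensorFun u x * v x)) := by
    refine setIntegral_congr_fun (isOpen_openBox a b).measurableSet fun x hx => ?_
    simp only
    rw [inner_eq_sum, Finset.sum_mul, ← Finset.sum_sub_distrib]
    refine Finset.sum_congr rfl fun i _ => ?_
    rw [gradient_mul_apply hU hv, gradient_tensorFun_apply (c := fun i => φ i (x i))
      (fun i => (h i).hasDerivAt _ (Ioo_subset_Icc_self (hx i)))]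
    ring
  rw [h1, integral_sub, integral_const_mul] at key
  · linarith
  · exact memLp_one_iff_integrable.1 (memLp_restrict_openBox_of_continuousOn a b
      ((continuous_gradient hU).inner (continuous_gradient hv)).continuousOn 1)
  · exact memLp_one_iff_integrable.1 (memLp_restrict_openBox_of_continuousOn a b
      (continuous_const.mul (hU.continuous.mul hv.continuous)).continuousOn 1)

/-- For `f = v²`, the square `(∂ᵢv - v φᵢ)² ≥ 0` gives `2 v φᵢ ∂ᵢv - v² φᵢ² ≤ (∂ᵢv)²`, regardless of
the sign of `α`. -/
theorem robin_quadratic_form_ge (hab : ∀ i, a i < b i)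
    (h : ∀ i, IsRobinProfile α (μ i) (a i) (b i) (u i) (φ i))
    {v : EuclideanSpace ℝ (Fin (m + 1)) → ℝ} (hv : ContDiff ℝ 1 v) :
    (∑ i, μ i) * ∫ x in openBox a b, v x * v x ≤
      (∫ x in openBox a b, inner ℝ (gradient v x) (gradient v x)) +
        α * ∫ x, v x * v x ∂surfaceMeasure (openBox a b) := by
  have key := integral_robinProfile hab h (hv.mul hv)
  have hint : ∀ {f : EuclideanSpace ℝ (Fin (m + 1)) → ℝ},
      ContinuousOn f (closure (openBox a b)) → IntegrableOn f (openBox a b) := fun hf =>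
    memLp_one_iff_integrable.1 (memLp_restrict_openBox_of_continuousOn a b hf 1)
  have hg := continuous_gradient hv
  have h1 : ∫ x in openBox a b, ∑ i, (φ i (x i) * gradient (fun x => v x * v x) x i +
      v x * v x * (-μ i - φ i (x i) ^ 2)) ≤
      ∫ x in openBox a b, (inner ℝ (gradient v x) (gradient v x) - (∑ i, μ i) * (v x * v x)) := by
    refine setIntegral_mono_on (hint ?_) (hint ?_) (isOpen_openBox a b).measurableSet
      fun x hx => ?_
    · refine continuousOn_finsetSum _ fun i _ => ?_
      have h2 : ContinuousOn (fun x : EuclideanSpace ℝ (Fin (m + 1)) => φ i (x i))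
          (closure (openBox a b)) := by
        refine ContinuousOn.comp (t := Icc (a i) (b i)) (g := φ i)
          (fun x hx => ((h i).riccati x hx).continuousAt.continuousWithinAt)
          (by fun_prop) fun x hx => ?_
        rw [closure_openBox hab] at hx
        exact hx i
      have h3 : Continuous fun x => gradient (fun x => v x * v x) x i := by
        have := continuous_gradient (hv.mul hv)
        fun_prop
      have h4 := hv.continuous
      exact (h2.mul h3.continuousOn).add
        ((h4.mul h4).continuousOn.mul (continuousOn_const.sub (h2.pow 2)))
    · have := hv.continuous
      exact ((hg.inner hg).sub (continuous_const.mul (this.mul this))).continuousOn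
    · rw [inner_eq_sum, Finset.sum_mul, ← Finset.sum_sub_distrib]
      refine Finset.sum_le_sum fun i _ => ?_
      rw [gradient_mul_apply hv hv]
      nlinarith [sq_nonneg (gradient v x i - v x * φ i (x i))]
  rw [key, integral_sub, integral_const_mul] at h1
  · linarith
  · exact hint (hg.inner hg).continuousOn
  · have := hv.continuous
    exact hint (continuous_const.mul (this.mul this)).continuousOn

theorem contDiff_one_of_contDiff_infty {n : ℕ} {v : EuclideanSpace ℝ (Fin n) → ℝ}
    (hv : ContDiff ℝ ∞ v) : ContDiff ℝ 1 v :=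
  hv.of_le (by exact_mod_cast le_top)

theorem inH1_of_contDiff (a b : Fin (m + 1) → ℝ) {v : EuclideanSpace ℝ (Fin (m + 1)) → ℝ}
    (hv : ContDiff ℝ 1 v) : InH1 (openBox a b) v (gradient v) :=
  ⟨memLp_restrict_openBox_of_continuousOn a b hv.continuous.continuousOn 2,
    memLp_restrict_openBox_of_continuousOn a b (continuous_gradient hv).continuousOn 2,
    hasWeakGradient_gradient hv⟩

theorem hasTrace_of_contDiff (hab : ∀ i, a i < b i) {v : EuclideanSpace ℝ (Fin (m + 1)) → ℝ}
    (hv : ContDiff ℝ ∞ v) : HasTrace (openBox a b) v (gradient v) v :=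
  ⟨memLp_surfaceMeasure_of_continuous hab hv.continuous 2, fun _ => v, fun _ => hv, by simp,
    by simp, by simp⟩

theorem isRobinEigenvalue_sum (hab : ∀ i, a i < b i)
    (h : ∀ i, IsRobinProfile α (μ i) (a i) (b i) (u i) (φ i)) :
    IsRobinEigenvalue (openBox a b) α (∑ i, μ i) := by
  have hU : ContDiff ℝ ∞ (tensorFun u) := contDiff_tensorFun fun i => (h i).contDiff
  have hU1 := contDiff_one_of_contDiff_infty hU
  refine ⟨tensorFun u, gradient (tensorFun u), tensorFun u, inH1_of_contDiff a b hU1,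
    hasTrace_of_contDiff hab hU, fun h0 => ?_, ?_⟩
  · rw [ae_restrict_iff' (isOpen_openBox a b).measurableSet] at h0
    have hne : (openBox a b).Nonempty := by
      refine ⟨WithLp.toLp 2 fun i => (a i + b i) / 2, fun i => ?_⟩
      have := hab i
      constructor <;> simp <;> linarith
    have h1 : volume (openBox a b) = 0 := by
      refine measure_mono_null (fun x hx => ?_) h0
      intro h2
      refine (Finset.prod_pos fun i _ => ?_).ne' (h2 hx)
      exact (h i).pos _ (Ioo_subset_Icc_self (hx i))
    exact ((isOpen_openBox a b).measure_pos volume hne).ne' h1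
  -- The smooth functions defining the trace of `v` converge to it in `H¹` and on the boundary, so
  -- the identity for smooth test functions passes to the limit.
  · rintro v Gv gv hv ⟨hgv, w, hw, hw1, hw2, hw3⟩
    have hw' := fun k => contDiff_one_of_contDiff_infty (hw k)
    have hU2 := inH1_of_contDiff a b hU1
    have hU3 := memLp_surfaceMeasure_of_continuous hab hU.continuous 2
    have t1 := tendsto_integral_inner_of_tendsto_eLpNorm (l := atTop) (fun _ => hU2.memLp_gradient)
      (fun k => (inH1_of_contDiff a b (hw' k)).memLp_gradient) hU2.memLp_gradient hv.memLp_gradient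
      (by simp) hw2
    have t2 := tendsto_integral_mul_of_tendsto_eLpNorm (l := atTop) (fun _ => hU2.memLp)
      (fun k => (inH1_of_contDiff a b (hw' k)).memLp) hU2.memLp hv.memLp (by simp) hw1
    have t3 := tendsto_integral_mul_of_tendsto_eLpNorm (l := atTop) (fun _ => hU3)
      (fun k => memLp_surfaceMeasure_of_continuous hab (hw k).continuous 2) hU3 hgv (by simp) hw3
    refine tendsto_nhds_unique (t1.add (t3.const_mul α)) ?_
    simpa only [robin_weak_form_tensorFun hab h (hw' _)] using t2.const_mul (∑ i, μ i)

/-- An eigenfunction tested against itself has Rayleigh quotient `ν`, and the lower bound extends to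
it from smooth approximants. -/
theorem sum_le_of_isRobinEigenvalue (hab : ∀ i, a i < b i)
    (h : ∀ i, IsRobinProfile α (μ i) (a i) (b i) (u i) (φ i)) {ν : ℝ}
    (hν : IsRobinEigenvalue (openBox a b) α ν) : ∑ i, μ i ≤ ν := by
  obtain ⟨v, Gv, gv, hv, htr, hne, hweak⟩ := hν
  have heq := hweak v Gv gv hv htr
  obtain ⟨hgv, w, hw, hw1, hw2, hw3⟩ := htr
  have hw' := fun k => contDiff_one_of_contDiff_infty (hw k)
  have m1 := fun k => (inH1_of_contDiff a b (hw' k)).memLp_gradient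
  have m2 := fun k => (inH1_of_contDiff a b (hw' k)).memLp
  have m3 := fun k => memLp_surfaceMeasure_of_continuous hab (hw k).continuous 2
  have t1 := tendsto_integral_inner_of_tendsto_eLpNorm m1 m1 hv.memLp_gradient hv.memLp_gradient
    hw2 hw2
  have t2 := tendsto_integral_mul_of_tendsto_eLpNorm m2 m2 hv.memLp hv.memLp hw1 hw1
  have t3 := tendsto_integral_mul_of_tendsto_eLpNorm m3 m3 hgv hgv hw3 hw3
  have hle := le_of_tendsto_of_tendsto' (t2.const_mul (∑ i, μ i)) (t1.add (t3.const_mul α))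
    fun k => robin_quadratic_form_ge hab h (hw' k)
  rw [heq] at hle
  have hpos : 0 < ∫ x in openBox a b, v x * v x := by
    refine lt_of_le_of_ne (integral_nonneg fun x => mul_self_nonneg _) fun h0 => hne ?_
    have h1 := (integral_eq_zero_iff_of_nonneg (fun x => mul_self_nonneg (v x))
      (hv.memLp.integrable_mul hv.memLp)).1 h0.symm
    exact h1.mono fun x hx => mul_self_eq_zero.1 hx
  exact le_of_mul_le_mul_right hle hpos

theorem robinLambda1_openBox (hab : ∀ i, a i < b i)
    (h : ∀ i, IsRobinProfile α (μ i) (a i) (b i) (u i) (φ i)) :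
    robinLambda1 (openBox a b) α = ∑ i, μ i :=
  IsLeast.csInf_eq ⟨isRobinEigenvalue_sum hab h, fun _ hν => sum_le_of_isRobinEigenvalue hab h hν⟩

end Eigenvalue

/-! ### Convexity and comparison with the cube -/

section Conclusion

theorem volume_openBox {n : ℕ} {a b : Fin n → ℝ} (hab : ∀ i, a i < b i) :
    volume (openBox a b) = ENNReal.ofReal (∏ i, (b i - a i)) := by
  rw [openBox_eq_preimage, (PiLp.volume_preserving_ofLp (Fin n)).measure_preimage
    (MeasurableSet.univ_pi fun i => measurableSet_Ioo).nullMeasurableSet, Real.volume_pi_Ioo,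
    ENNReal.ofReal_prod_of_nonneg fun i _ => (sub_pos.2 (hab i)).le]

theorem strictConvexOn_sq_of_pos {g : ℝ → ℝ} (hg : ∀ z, 0 < g z) (hc : StrictConvexOn ℝ univ g) :
    StrictConvexOn ℝ univ (fun z => g z ^ 2) := by
  refine ⟨convex_univ, fun x _ y _ hxy a b ha hb hab => ?_⟩
  have h1 := hc.2 (mem_univ x) (mem_univ y) hxy ha hb hab
  simp only [smul_eq_mul] at h1 ⊢
  have h2 := pow_lt_pow_left₀ h1 (hg _).le two_ne_zero
  refine h2.trans_le ?_
  obtain rfl : b = 1 - a := by linarith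
  nlinarith [mul_nonneg (mul_nonneg ha.le hb.le) (sq_nonneg (g x - g y))]

/-- The root is the norm of `(g(zᵢ))`. Strictness comes from one coordinate where the two points
differ: there `g` drops strictly below the chord, and the norm strictly increases in positive
coordinates. The triangle inequality does the rest. -/
theorem strictConvexOn_sqrt_sum_sq {n : ℕ} {g : ℝ → ℝ} (hg : ∀ z, 0 < g z)
    (hc : StrictConvexOn ℝ univ g) :
    StrictConvexOn ℝ univ (fun z : Fin n → ℝ => √(∑ i, g (z i) ^ 2)) := by
  refine ⟨convex_univ, fun x _ y _ hxy s t hs ht hst => ?_⟩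
  obtain ⟨k, hk⟩ := Function.ne_iff.1 hxy
  let K : (Fin n → ℝ) → EuclideanSpace ℝ (Fin n) := fun z => WithLp.toLp 2 fun i => g (z i)
  have hK : ∀ z, √(∑ i, g (z i) ^ 2) = ‖K z‖ := fun z => by simp [EuclideanSpace.norm_eq, K]
  have h1 : √(∑ i, g ((s • x + t • y) i) ^ 2) < ‖s • K x + t • K y‖ := by
    rw [EuclideanSpace.norm_eq]
    refine Real.sqrt_lt_sqrt (Finset.sum_nonneg fun i _ => sq_nonneg _) ?_
    have hsq : ∀ i, ‖(s • K x + t • K y) i‖ ^ 2 = (s * g (x i) + t * g (y i)) ^ 2 := fun i => by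
      simp [K]
    refine Finset.sum_lt_sum (fun i _ => ?_) ⟨k, Finset.mem_univ k, ?_⟩
    · rw [hsq]
      exact pow_le_pow_left₀ (hg _).le
        (hc.convexOn.2 (mem_univ (x i)) (mem_univ (y i)) hs.le ht.le hst) 2
    · rw [hsq]
      exact pow_lt_pow_left₀ (hc.2 (mem_univ (x k)) (mem_univ (y k)) hk hs ht hst) (hg _).le
        two_ne_zero
  simp only [hK, smul_eq_mul] at h1 ⊢
  refine h1.trans_le ((norm_add_le _ _).trans ?_)
  rw [norm_smul, norm_smul, Real.norm_of_nonneg hs.le, Real.norm_of_nonneg ht.le]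

/-- In logarithmic coordinates the volume constraint is linear, which is the form Jensen's
inequality needs. -/
theorem sum_log_half_eq_of_volume_eq {n : ℕ} {a b a' : Fin n → ℝ} {ℓ : ℝ} (hab : ∀ i, a i < b i)
    (hℓ : 0 < ℓ) (hvol : volume (openBox a b) = volume (openBox a' fun i => a' i + ℓ)) :
    ∑ i, Real.log ((b i - a i) / 2) = n * Real.log (ℓ / 2) := by
  have hpos : ∀ i, 0 < b i - a i := fun i => sub_pos.2 (hab i)
  rw [volume_openBox hab, volume_openBox (fun i => by linarith),
    ENNReal.ofReal_eq_ofReal_iff (Finset.prod_nonneg fun i _ => (hpos i).le)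
      (Finset.prod_nonneg fun i _ => by linarith)] at hvol
  have h := congrArg Real.log hvol
  rw [Real.log_prod fun i _ => (hpos i).ne', Real.log_prod fun i _ => by simpa using hℓ.ne'] at h
  have h2 : ∀ i, Real.log ((b i - a i) / 2) = Real.log (b i - a i) - Real.log 2 := fun i =>
    Real.log_div (hpos i).ne' two_ne_zero
  simp only [h2, Finset.sum_sub_distrib, h, Real.log_div hℓ.ne' two_ne_zero]
  simp
  ring

/-- Strict Jensen inequality for equal weights. -/
theorem StrictConvexOn.card_mul_le_sum {n : ℕ} (hn : 1 ≤ n) {G : ℝ → ℝ}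
    (hG : StrictConvexOn ℝ univ G) {z : Fin n → ℝ} {c : ℝ} (hz : ∑ i, z i = n * c) :
    n * G c ≤ ∑ i, G (z i) ∧ (∑ i, G (z i) = n * G c → ∀ i, z i = c) := by
  have hn0 : (0 : ℝ) < n := by exact_mod_cast hn
  have hw : ∑ _i : Fin n, (1 / n : ℝ) = 1 := by simp [hn0.ne']
  have hc : ∑ i, (1 / n : ℝ) • z i = c := by
    rw [← Finset.smul_sum, hz, smul_eq_mul]; field_simp
  have hS : ∑ i, (1 / n : ℝ) • G (z i) = (∑ i, G (z i)) / n := by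
    rw [← Finset.smul_sum, smul_eq_mul]; ring
  constructor
  · have h := hG.convexOn.map_sum_le (t := Finset.univ) (w := fun _ => (1 / n : ℝ)) (p := z)
      (fun _ _ => by positivity) hw (fun _ _ => mem_univ _)
    rw [hc, hS, le_div_iff₀ hn0] at h
    linarith
  · intro h i
    have h' := (hG.map_sum_eq_iff (t := Finset.univ) (w := fun _ => (1 / n : ℝ)) (p := z)
      (fun _ _ => by positivity) hw (fun _ _ => mem_univ _)).1
        (by rw [hc, hS, h]; field_simp) i (Finset.mem_univ i)
    rw [h', hc]

/-- One `g`, depending only on `α`, serves all dimensions, boxes and edges; this makes boxes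
comparable. -/
theorem exists_robinLambda1_openBox {α : ℝ} (hα : α ≠ 0) :
    ∃ g : ℝ → ℝ, (∀ z, 0 < g z) ∧ StrictConvexOn ℝ univ g ∧
      ∀ (n : ℕ) (_ : 1 ≤ n) (a b : Fin n → ℝ), (∀ i, a i < b i) →
        robinLambda1 (openBox a b) α =
          (SignType.sign α : ℝ) * ∑ i, g (Real.log ((b i - a i) / 2)) ^ 2 := by
  have main : ∀ g : ℝ → ℝ, (∀ a b, a < b → ∃ u φ,
      IsRobinProfile α ((SignType.sign α : ℝ) * g (Real.log ((b - a) / 2)) ^ 2) a b u φ) →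
      ∀ (n : ℕ) (_ : 1 ≤ n) (a b : Fin n → ℝ), (∀ i, a i < b i) →
        robinLambda1 (openBox a b) α =
          (SignType.sign α : ℝ) * ∑ i, g (Real.log ((b i - a i) / 2)) ^ 2 := by
    intro g hg n hn a b hab
    obtain ⟨m, rfl⟩ : ∃ m, n = m + 1 := ⟨n - 1, by omega⟩
    choose u φ h using fun i => hg (a i) (b i) (hab i)
    rw [robinLambda1_openBox hab h, Finset.mul_sum]
  rcases hα.lt_or_gt with hα | hα
  · obtain ⟨g, h1, h2, h3⟩ := exists_robinProfile_of_neg hα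
    exact ⟨g, h1, h2, main g (by simpa [sign_neg hα] using h3)⟩
  · obtain ⟨g, h1, h2, h3⟩ := exists_robinProfile_of_pos hα
    exact ⟨g, h1, h2, main g (by simpa [sign_pos hα] using h3)⟩

/-- The factor `sign α` merges minimality for `α > 0` with maximality for `α < 0`: either way `∑
g(zᵢ)²` is minimized under fixed `∑ zᵢ`. -/
theorem sign_mul_robinLambda1_cube_le_box {n : ℕ} (hn : 1 ≤ n) {α : ℝ} (hα : α ≠ 0)
    {Q B : Set (EuclideanSpace ℝ (Fin n))} (hQ : IsCube Q) (hB : IsRectangularBox B)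
    (hvol : volume B = volume Q) :
    (SignType.sign α : ℝ) * robinLambda1 Q α ≤ (SignType.sign α : ℝ) * robinLambda1 B α ∧
      (robinLambda1 B α = robinLambda1 Q α ↔ IsCube B) := by
  obtain ⟨g, hpos, hconv, hg⟩ := exists_robinLambda1_openBox hα
  have hs : (SignType.sign α : ℝ) * (SignType.sign α : ℝ) = 1 := by
    rcases hα.lt_or_gt with h | h
    · simp [sign_neg h]
    · simp [sign_pos h]
  have hs0 : (SignType.sign α : ℝ) ≠ 0 := left_ne_zero_of_mul_eq_one hs
  obtain ⟨a', ℓ, hℓ, rfl⟩ := hQ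
  have hQ' : robinLambda1 (openBox a' fun i => a' i + ℓ) α =
      (SignType.sign α : ℝ) * (n * g (Real.log (ℓ / 2)) ^ 2) := by
    rw [hg n hn _ _ fun i => by linarith]
    simp
  have hsq := strictConvexOn_sq_of_pos hpos hconv
  constructor
  · obtain ⟨a, b, hab, rfl⟩ := hB
    rw [hQ', hg n hn a b hab, ← mul_assoc, hs, one_mul, ← mul_assoc, hs, one_mul]
    exact (hsq.card_mul_le_sum hn (sum_log_half_eq_of_volume_eq hab hℓ hvol)).1
  · constructor
    · obtain ⟨a, b, hab, rfl⟩ := hB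
      intro h
      rw [hQ', hg n hn a b hab] at h
      have h1 := (hsq.card_mul_le_sum hn (sum_log_half_eq_of_volume_eq hab hℓ hvol)).2
        (mul_left_cancel₀ hs0 h)
      refine ⟨a, ℓ, hℓ, congrArg _ (funext fun i => ?_)⟩
      have h2 := Real.log_injOn_pos (show 0 < (b i - a i) / 2 by linarith [hab i])
        (show 0 < ℓ / 2 by positivity) (h1 i)
      linarith
    -- Two cubes of equal volume have equal edges, hence equal eigenvalues.
    · rintro ⟨a, l, hl, rfl⟩
      have h1 := sum_log_half_eq_of_volume_eq (fun i => by linarith) hℓ hvol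
      have hn0 : (n : ℝ) ≠ 0 := by exact_mod_cast (by omega : n ≠ 0)
      simp only [add_sub_cancel_left, Finset.sum_const, Finset.card_univ, Fintype.card_fin,
        nsmul_eq_mul] at h1
      rw [hQ', hg n hn _ _ fun i => by linarith, ← mul_left_cancel₀ hn0 h1]
      simp

theorem sign_mul_robinLambda1_pos {n : ℕ} (hn : 1 ≤ n) {α : ℝ} (hα : α ≠ 0)
    {B : Set (EuclideanSpace ℝ (Fin n))} (hB : IsRectangularBox B) :
    0 < (SignType.sign α : ℝ) * robinLambda1 B α := by
  obtain ⟨g, hpos, -, hg⟩ := exists_robinLambda1_openBox hα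
  obtain ⟨a, b, hab, rfl⟩ := hB
  have : Nonempty (Fin n) := ⟨⟨0, hn⟩⟩
  have h : 0 < ∑ i, g (Real.log ((b i - a i) / 2)) ^ 2 :=
    Finset.sum_pos (fun i _ => pow_pos (hpos _) 2) Finset.univ_nonempty
  rw [hg n hn a b hab]
  rcases hα.lt_or_gt with h' | h'
  · simpa [sign_neg h'] using h
  · simpa [sign_pos h'] using h

theorem strictConvexOn_sqrt_abs_robinLambda1 {n : ℕ} (hn : 1 ≤ n) {α : ℝ} (hα : α ≠ 0) :
    StrictConvexOn ℝ univ (fun z : Fin n → ℝ =>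
      Real.sqrt |robinLambda1 (centeredBox (fun i => Real.exp (z i))) α|) := by
  obtain ⟨g, hpos, hconv, hg⟩ := exists_robinLambda1_openBox hα
  convert strictConvexOn_sqrt_sum_sq (n := n) hpos hconv using 3 with z
  rw [centeredBox, hg n hn _ _ fun i => by have := Real.exp_pos (z i); linarith, abs_mul]
  have h1 : |(SignType.sign α : ℝ)| = 1 := by
    rcases hα.lt_or_gt with h' | h'
    · simp [sign_neg h']
    · simp [sign_pos h']
  rw [h1, one_mul, abs_of_nonneg (Finset.sum_nonneg fun i _ => sq_nonneg _)]
  refine Finset.sum_congr rfl fun i _ => ?_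
  rw [show (Real.exp (z i) - -Real.exp (z i)) / 2 = Real.exp (z i) by ring, Real.log_exp]

end Conclusion

theorem mainTheorem5 (n : ℕ) (hn : 1 ≤ n) (α : ℝ) :
    (0 < α →
      (∀ B : Set (EuclideanSpace ℝ (Fin n)), IsRectangularBox B → 0 < robinLambda1 B α) ∧
      (∀ Q B : Set (EuclideanSpace ℝ (Fin n)), IsCube Q → IsRectangularBox B →
        volume B = volume Q →
        robinLambda1 Q α ≤ robinLambda1 B α ∧
        (robinLambda1 B α = robinLambda1 Q α ↔ IsCube B))) ∧
    (α < 0 →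
      (∀ B : Set (EuclideanSpace ℝ (Fin n)), IsRectangularBox B → robinLambda1 B α < 0) ∧
      (∀ Q B : Set (EuclideanSpace ℝ (Fin n)), IsCube Q → IsRectangularBox B →
        volume B = volume Q →
        robinLambda1 B α ≤ robinLambda1 Q α ∧
        (robinLambda1 B α = robinLambda1 Q α ↔ IsCube B))) ∧
    (α ≠ 0 →
      StrictConvexOn ℝ univ (fun z : Fin n → ℝ =>
        Real.sqrt |robinLambda1 (centeredBox (fun i => Real.exp (z i))) α|)) := by
  refine ⟨fun hα => ⟨fun B hB => ?_, fun Q B hQ hB hvol => ?_⟩,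
    fun hα => ⟨fun B hB => ?_, fun Q B hQ hB hvol => ?_⟩,
    fun hα => strictConvexOn_sqrt_abs_robinLambda1 hn hα⟩
  · simpa [sign_pos hα] using sign_mul_robinLambda1_pos hn hα.ne' hB
  · simpa [sign_pos hα] using sign_mul_robinLambda1_cube_le_box hn hα.ne' hQ hB hvol
  · simpa [sign_neg hα] using sign_mul_robinLambda1_pos hn hα.ne hB
  · simpa [sign_neg hα] using sign_mul_robinLambda1_cube_le_box hn hα.ne hQ hB hvol
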